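/- For a finite simple graph $G$ and $S \subseteq V(G)$, let $\delta(S) = \{v \in V(G)\setminus S : N(v)\cap S \neq \emptyset\}$ be the vertex-border of $S$; for $0 \le s \le |V(G)|$ let $\Phi_V(G,s) = \min_{S \subseteq V(G),\, |S| = s} |\delta(S)|$, and let the vertex-isoperimetric peak of $G$ be $\Phi_V(G) = \max_{0 \le s \le |V(G)|} \Phi_V(G,s)$. The complete $q$-ary tree of depth $d$ is the rooted tree in which every vertex at distance less than $d$ from the root has exactly $q$ children and every vertex at distance $d$ from the root is a leaf, i.e. has no children. Theorem 1.4. Let $q \ge 5$ and $d \ge 0$ be integers and let $T$ be a complete $q$-ary tree of depth $d$. Then \[ \Phi_V(T) = d. \] -/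

import Mathlib

namespace SimpleGraph

/-- The vertex-border `δ(S)`: the vertices outside `S` that have a neighbour in `S`. -/
noncomputable def vertexBorder {V : Type*} [Fintype V] (G : SimpleGraph V) (S : Finset V) :
    Finset V :=
  open Classical in
  Finset.univ.filter fun v => v ∉ S ∧ (G.neighborSet v ∩ (S : Set V)).Nonempty

/-- The vertex-isoperimetric parameter `Φ_V(G, s)`: the minimum of `|δ(S)|` over all sets `S` of
exactly `s` vertices. Such sets exist precisely when `s ≤ |V|`, and only these values of `s` are
used below. -/
noncomputable def vertexIsoParam {V : Type*} [Fintype V] (G : SimpleGraph V) (s : ℕ) : ℕ :=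
  sInf {b : ℕ | ∃ S : Finset V, S.card = s ∧ (G.vertexBorder S).card = b}

/-- The vertex-isoperimetric peak `Φ_V(G)`: the maximum of `Φ_V(G, s)` over `0 ≤ s ≤ |V|`. -/
noncomputable def vertexIsoPeak {V : Type*} [Fintype V] (G : SimpleGraph V) : ℕ :=
  (Finset.range (Fintype.card V + 1)).sup G.vertexIsoParam

/-- The children of `v` in a tree `G` rooted at `r`: the neighbours of `v` that are one step
further from the root. -/
def childSet {V : Type*} (G : SimpleGraph V) (r v : V) : Set V :=
  {w | G.Adj v w ∧ G.dist r w = G.dist r v + 1}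

/-- `G` with root `r` is a complete `q`-ary tree of depth `d`: it is a tree in which every vertex
at distance less than `d` from the root has exactly `q` children, and the vertices at distance `d`
are leaves, that is, they have no children (so their degree is `1` if `d ≥ 1`, and for `d = 0` the
tree is a single vertex). -/
structure IsCompleteAryTree {V : Type*} (G : SimpleGraph V) (r : V) (q d : ℕ) : Prop where
  isTree : G.IsTree
  encard_childSet : ∀ v, G.dist r v < d → (G.childSet r v).encard = q
  childSet_eq_empty : ∀ v, G.dist r v = d → G.childSet r v = ∅

end SimpleGraph

/-! Upper bound: split `s` greedily into complete subtrees. On each level take as many full child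
subtrees as fit and push the remainder into one further child. The resulting set is closed under
children, and only the vertices of the descending path, one per level above the leaves, can border
it (`exists_childClosed`).

Lower bound: let `s` be the sum of the `extremalLevel` values and `|S| = s`. On level `k`, let `x`
count `S`, `n` the border, `e` the border vertices with parent in `S`, and put `w = extremalLevel q
k - x - e`. A vertex of `S` whose parent is outside `S` has a border parent, so `w (k + 1) - (q * w
k + 2)` lies between `-q * (n k - e k)` and `q * e k`, while `∑ (w + e) = 0`. A level free of border
forces `w (k + 1) = q * w k + 2`, a growth that the zero sum penalises; two potentials turn this
into `∑ n ≥ d` (`le_sum_of_recursion`). -/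

/-- The correction `c(w)` for which `∑ (n - 1) + ∑ (w + e) + c(w)` stays nonnegative along the
recursion of `le_sum_of_recursion`. -/
def penaltyPos (v : ℤ) : ℤ := if 2 ≤ v then 1 else if -1 ≤ v then 0 else -v - 1

/-- The correction `c(w)` for which `2 ∑ (n - 1) - ∑ (w + e) + c(w)` stays nonnegative along the
recursion of `le_sum_of_recursion`. -/
def penaltyNeg (v : ℤ) : ℤ := if 0 ≤ v then v else if -2 ≤ v then 0 else 1

lemma penaltyPos_step {q v x p e : ℤ} (hq : 5 ≤ q) (hp : 0 ≤ p) (he : 0 ≤ e)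
    (hl : 2 + q * v - x ≤ q * p) (hu : -(q * e) ≤ 2 + q * v - x) :
    penaltyPos v ≤ (p + e - 1) + (v + e) + penaltyPos x := by
  have h0 : 0 ≤ penaltyPos x := by unfold penaltyPos; split_ifs <;> omega
  have hl' : 2 + q * (v - p) ≤ x := by linarith
  have hu' : x ≤ 2 - q * (-v - e) := by linarith
  have key1 : 0 ≤ v - p → 2 ≤ x := fun h => by nlinarith
  -- With `t = -v - e ≥ 1`, the bound `2 - q * t ≤ -2 * t - 1` needs `q ≥ 5`.
  have key2 : 0 < -v - e → penaltyPos x ≥ 2 * (-v - e) := fun h => by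
    have : x ≤ -(2 * (-v - e)) - 1 := by nlinarith
    unfold penaltyPos; split_ifs <;> omega
  have key3 : 2 ≤ x → penaltyPos x = 1 := fun h => by simp [penaltyPos, h]
  generalize penaltyPos x = y at *
  unfold penaltyPos
  split_ifs <;> grind

lemma penaltyNeg_step {q v x p e : ℤ} (hq : 5 ≤ q) (hp : 0 ≤ p) (he : 0 ≤ e)
    (hl : 2 + q * v - x ≤ q * p) (hu : -(q * e) ≤ 2 + q * v - x) :
    penaltyNeg v ≤ 2 * (p + e - 1) - (v + e) + penaltyNeg x := by
  have h0 : 0 ≤ penaltyNeg x := by unfold penaltyNeg; split_ifs <;> omega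
  have hl' : 2 + q * (v - p) ≤ x := by linarith
  have hu' : x ≤ 2 - q * (-v - e) := by linarith
  have key1 : 0 ≤ v - p → penaltyNeg x ≥ 2 + 2 * (v - p) := fun h => by
    have : 2 + 2 * (v - p) ≤ x := by nlinarith
    unfold penaltyNeg; split_ifs <;> omega
  -- Again `q ≥ 5` is sharp: `x ≤ 2 - q ≤ -3` just leaves the range where the penalty vanishes.
  have key2 : 0 < -v - e → penaltyNeg x ≥ 1 := fun h => by
    have : x ≤ -3 := by nlinarith
    unfold penaltyNeg; split_ifs <;> omega
  generalize penaltyNeg x = y at *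
  unfold penaltyNeg
  split_ifs <;> grind

/-- A balanced integer recursion `w (k + 1) ≈ q * w k + 2` can only be sustained for `d` steps if
the corrections `n` add up to at least `d`. -/
lemma le_sum_of_recursion {q : ℤ} (hq : 5 ≤ q) (d : ℕ) (w n e : ℕ → ℤ)
    (hw0 : w 0 = 0 ∨ w 0 = -1) (he : ∀ k, 0 ≤ e k) (hen : ∀ k, e k ≤ n k)
    (hl : ∀ k < d, 2 + q * w k - w (k + 1) ≤ q * (n k - e k))
    (hu : ∀ k < d, -(q * e k) ≤ 2 + q * w k - w (k + 1))
    (hsum : ∑ k ∈ Finset.range (d + 1), (w k + e k) = 0) :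
    (d : ℤ) ≤ ∑ k ∈ Finset.range (d + 1), n k := by
  have main : ∀ m ≤ d,
      -penaltyPos (w m) ≤ ∑ k ∈ Finset.range m, n k - m + ∑ k ∈ Finset.range m, (w k + e k) ∧
      -penaltyNeg (w m) ≤
        2 * (∑ k ∈ Finset.range m, n k - m) - ∑ k ∈ Finset.range m, (w k + e k) := by
    intro m
    induction m with
    | zero => rcases hw0 with h | h <;> simp [h, penaltyPos, penaltyNeg]
    | succ m ih =>
      intro hm
      obtain ⟨i1, i2⟩ := ih (by omega)
      have hp : 0 ≤ n m - e m := by linarith [hen m]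
      have s1 := penaltyPos_step hq hp (he m) (hl m hm) (hu m hm)
      have s2 := penaltyNeg_step hq hp (he m) (hl m hm) (hu m hm)
      rw [Finset.sum_range_succ, Finset.sum_range_succ]
      push_cast
      constructor <;> linarith
  obtain ⟨h1, h2⟩ := main d le_rfl
  rw [Finset.sum_range_succ] at hsum ⊢
  have hed := he d
  have hend := hen d
  generalize ∑ k ∈ Finset.range d, (w k + e k) = a at *
  generalize ∑ k ∈ Finset.range d, n k = b at *
  unfold penaltyPos at h1
  unfold penaltyNeg at h2
  -- The bound `h1` suffices when `w d ≥ 0`, and `h2` when `w d < 0`.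
  split_ifs at h1 h2 <;> omega

namespace SimpleGraph

/-! ### Parents and levels in a rooted tree -/

section
variable {V : Type*} {G : SimpleGraph V} {r : V}

/-- Parents are unique: geodesics from `r` to `u` and `u'`, extended to `v`, are both the unique
path to `v`. -/
lemma IsTree.eq_of_adj_of_dist_eq (hG : G.IsTree) {u u' v : V} (h : G.Adj u v) (h' : G.Adj u' v)
    (hd : G.dist r v = G.dist r u + 1) (hd' : G.dist r v = G.dist r u' + 1) : u = u' := by
  obtain ⟨p, hp⟩ := hG.connected.exists_walk_length_eq_dist r u
  obtain ⟨p', hp'⟩ := hG.connected.exists_walk_length_eq_dist r u'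
  have h1 : (p.concat h).IsPath := Walk.isPath_of_length_eq_dist _ (by simp [hp, hd])
  have h2 : (p'.concat h').IsPath := Walk.isPath_of_length_eq_dist _ (by simp [hp', hd'])
  have := (hG.existsUnique_path r v).unique h1 h2
  simpa using congrArg Walk.penultimate this

lemma Connected.exists_adj_dist_eq (hG : G.Connected) {v : V} {k : ℕ} (hv : G.dist r v = k + 1) :
    ∃ u, G.Adj u v ∧ G.dist r u = k := by
  obtain ⟨p, hp⟩ := hG.exists_walk_length_eq_dist v r
  rw [dist_comm, hv] at hp
  cases p with
  | nil => simp at hp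
  | @cons _ u _ h p =>
    refine ⟨u, h.symm, ?_⟩
    have h1 := dist_le p
    have h2 : G.dist r v ≤ G.dist r u + G.dist u v := hG.dist_triangle
    have h3 := dist_eq_one_iff_adj.2 h.symm
    simp only [Walk.length_cons] at hp
    rw [dist_comm] at h1
    omega

lemma card_eq_sum_level {n : ℕ} (S : Finset V) (h : ∀ v ∈ S, G.dist r v < n) :
    S.card = ∑ k ∈ Finset.range n, {v ∈ S | G.dist r v = k}.card :=
  Finset.card_eq_sum_card_fiberwise fun v hv => by simpa using h v hv

lemma IsCompleteAryTree.dist_le {q d : ℕ} (hT : G.IsCompleteAryTree r q d) (v : V) :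
    G.dist r v ≤ d := by
  have key : ∀ j v, G.dist r v ≠ d + j + 1 := by
    intro j
    induction j with
    | zero =>
      intro v hv
      obtain ⟨u, hu, hd⟩ := hT.isTree.connected.exists_adj_dist_eq hv
      have : v ∈ G.childSet r u := ⟨hu, by omega⟩
      simp [hT.childSet_eq_empty u hd] at this
    | succ j ih =>
      intro v hv
      obtain ⟨u, hu, hd⟩ := hT.isTree.connected.exists_adj_dist_eq hv
      exact ih u hd
  by_contra h
  exact key (G.dist r v - d - 1) v (by omega)

end

section
variable {V : Type*} [Fintype V] {T : SimpleGraph V} {r : V} {q d : ℕ}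

/-- The vertices at distance `k` from the root `r`. -/
noncomputable def level (G : SimpleGraph V) (r : V) (k : ℕ) : Finset V :=
  open Classical in Finset.univ.filter fun v => G.dist r v = k

/-- The children of the vertices in `A`. -/
noncomputable def childFinset (G : SimpleGraph V) (r : V) (A : Finset V) : Finset V :=
  open Classical in Finset.univ.filter fun w => ∃ u ∈ A, w ∈ G.childSet r u

@[simp] lemma mem_level {k : ℕ} {v : V} : v ∈ T.level r k ↔ T.dist r v = k := by simp [level]

@[simp] lemma mem_childFinset {A : Finset V} {w : V} :
    w ∈ T.childFinset r A ↔ ∃ u ∈ A, T.Adj u w ∧ T.dist r w = T.dist r u + 1 := by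
  simp only [childFinset, Finset.mem_filter, Finset.mem_univ, true_and]
  rfl

lemma mem_vertexBorder {S : Finset V} {v : V} :
    v ∈ T.vertexBorder S ↔ v ∉ S ∧ ∃ u ∈ S, T.Adj v u := by
  simp only [vertexBorder, Finset.mem_filter, Finset.mem_univ, true_and]
  exact and_congr_right fun _ => ⟨fun ⟨u, hu, h⟩ => ⟨u, h, hu⟩, fun ⟨u, hu, h⟩ => ⟨u, h, hu⟩⟩

namespace IsCompleteAryTree

lemma card_childFinset (hT : T.IsCompleteAryTree r q d) {A : Finset V}
    (hA : ∀ v ∈ A, T.dist r v < d) : (T.childFinset r A).card = q * A.card := by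
  classical
  have h : T.childFinset r A = A.biUnion fun u => (T.childSet r u).toFinset := by
    ext w
    simp only [mem_childFinset, Finset.mem_biUnion, Set.mem_toFinset]
    rfl
  rw [h, Finset.card_biUnion, Finset.sum_congr rfl (g := fun _ => q), Finset.sum_const,
    smul_eq_mul, mul_comm]
  · intro u hu
    have := hT.encard_childSet u (hA u hu)
    rw [Set.encard_eq_coe_toFinset_card] at this
    exact_mod_cast this
  · intro u _ u' _ hne
    rw [Function.onFun, Finset.disjoint_left]
    intro w hw hw'
    rw [Set.mem_toFinset] at hw hw'
    exact hne (hT.isTree.eq_of_adj_of_dist_eq hw.1 hw'.1 hw.2 hw'.2)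

lemma card_level (hT : T.IsCompleteAryTree r q d) {k : ℕ} (hk : k ≤ d) :
    (T.level r k).card = q ^ k := by
  induction k with
  | zero =>
    have : T.level r 0 = {r} := by
      ext v
      simp [hT.isTree.connected.dist_eq_zero_iff, eq_comm]
    simp [this]
  | succ k ih =>
    have : T.level r (k + 1) = T.childFinset r (T.level r k) := by
      ext v
      simp only [mem_level, mem_childFinset]
      constructor
      · intro hv
        obtain ⟨u, hu, hd⟩ := hT.isTree.connected.exists_adj_dist_eq hv
        exact ⟨u, hd, hu, by omega⟩
      · rintro ⟨u, hd, -, h⟩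
        omega
    rw [this, hT.card_childFinset (by simp; omega), ih (by omega), pow_succ']

lemma card_univ (hT : T.IsCompleteAryTree r q d) :
    Fintype.card V = ∑ k ∈ Finset.range (d + 1), q ^ k := by
  rw [← Finset.card_univ, card_eq_sum_level (G := T) (r := r) (n := d + 1)]
  · refine Finset.sum_congr rfl fun k hk => ?_
    rw [← hT.card_level (k := k) (by simpa [Nat.lt_succ_iff] using hk)]
    congr 1
  · intro v _
    exact Nat.lt_succ_of_le (hT.dist_le v)

/-! ### Upper bound: greedy filling by subtrees -/

/-- Given the set `A` at level `k` and a further vertex `u` of that level, `A` together with all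
its descendants can be enlarged by `s` proper descendants of `u`, with at most one border vertex on
each level from `k` to `d - 1`. -/
lemma exists_childClosed (hT : T.IsCompleteAryTree r q d) (hq : 0 < q) (h : ℕ) :
    ∀ (k : ℕ) (A : Finset V) (u : V) (s : ℕ), k + h = d → (∀ v ∈ A, T.dist r v = k) →
      T.dist r u = k → s < ∑ i ∈ Finset.range (h + 1), q ^ i → (u ∈ A → s = 0) →
      ∃ S B : Finset V, (∀ x ∈ S, k ≤ T.dist r x) ∧ (∀ x, T.dist r x = k → (x ∈ S ↔ x ∈ A)) ∧
        (∀ x ∈ S, ∀ y ∈ T.childSet r x, y ∈ S) ∧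
        S.card = A.card * ∑ i ∈ Finset.range (h + 1), q ^ i + s ∧ B.card ≤ h ∧
        ∀ v ∉ S, k ≤ T.dist r v → ∀ y ∈ S, y ∈ T.childSet r v → v ∈ B := by
  classical
  induction h with
  | zero =>
    intro k A u s hk hA hu hs _
    have h0 : ∀ x y : V, T.dist r x ≥ k → y ∉ T.childSet r x := fun x y hx => by
      simp [hT.childSet_eq_empty x (le_antisymm (hT.dist_le x) (by omega))]
    refine ⟨A, ∅, fun x hx => (hA x hx).ge, fun x _ => Iff.rfl,
      fun x hx y hy => (h0 x y (hA x hx).ge hy).elim, ?_, by simp,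
      fun v _ hv y _ hy => (h0 v y hv hy).elim⟩
    simp at hs ⊢
    omega
  | succ h ih =>
    intro k A u s hk hA hu hs huA
    rw [geom_sum_succ] at hs ⊢
    set a := ∑ i ∈ Finset.range (h + 1), q ^ i with ha
    have ha0 : 0 < a := by rw [ha, geom_sum_succ]; omega
    have hchu : (T.childFinset r {u}).card = q := by
      simpa using hT.card_childFinset (A := {u}) (by simp; omega)
    have hsq : s / a ≤ q := by
      rw [← Nat.lt_succ_iff, Nat.div_lt_iff_lt_mul ha0]
      rw [Nat.succ_mul]
      omega
    obtain ⟨R, hRu, hR⟩ := Finset.exists_subset_card_eq (hsq.trans hchu.ge)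
    have hRu' : ∀ y ∈ R, T.Adj u y ∧ T.dist r y = k + 1 := fun y hy => by
      simpa [hu] using hRu hy
    have hdisj : Disjoint (T.childFinset r A) R := by
      rw [Finset.disjoint_left]
      intro y hy hyR
      obtain ⟨v, hv, hvy, hd⟩ := mem_childFinset.1 hy
      obtain ⟨huy, hd'⟩ := hRu' y hyR
      have : v = u := hT.isTree.eq_of_adj_of_dist_eq hvy huy hd (by omega)
      subst this
      have : R = ∅ := by rw [← Finset.card_eq_zero, hR, huA hv, Nat.zero_div]
      simp [this] at hyR
    -- The child `u'` receives the remainder `s % a`, so it must not already be full, unless the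
    -- remainder is zero (as when `s / a = q`).
    obtain ⟨u', hu'c, hu'⟩ : ∃ u' ∈ T.childFinset r {u},
        (u' ∈ T.childFinset r A ∪ R → s % a = 0) := by
      by_cases hlt : s / a < q
      · by_cases huA' : u ∈ A
        · obtain ⟨u', hu'⟩ := Finset.card_pos.1 (hchu.symm ▸ hq)
          exact ⟨u', hu', fun _ => by simp [huA huA']⟩
        obtain ⟨u', hu', hn⟩ := Finset.exists_mem_notMem_of_card_lt_card
          (s := R) (t := T.childFinset r {u}) (by omega)
        refine ⟨u', hu', fun hm => ?_⟩
        rcases Finset.mem_union.1 hm with hm | hm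
        · obtain ⟨v, hv, hvy, hd⟩ := mem_childFinset.1 hm
          obtain ⟨w, hw, hwy, hd'⟩ := mem_childFinset.1 hu'
          have : v = w := hT.isTree.eq_of_adj_of_dist_eq hvy hwy hd hd'
          rw [Finset.mem_singleton] at hw
          exact (huA' (by rwa [← hw, ← this])).elim
        · exact (hn hm).elim
      · obtain ⟨u', hu'⟩ := Finset.card_pos.1 (hchu.symm ▸ hq)
        refine ⟨u', hu', fun _ => ?_⟩
        have h1 : s / a = q := by omega
        have h2 := Nat.div_add_mod s a
        rw [h1, mul_comm] at h2
        omega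
    have hu'd : T.dist r u' = k + 1 := by
      obtain ⟨w, hw, -, hd⟩ := mem_childFinset.1 hu'c
      rw [hd, Finset.mem_singleton.1 hw, hu]
    obtain ⟨S, B, hS1, hS2, hS3, hS4, hB, hSB⟩ := ih (k + 1) (T.childFinset r A ∪ R) u' (s % a)
      (by omega) (fun v hv => by
        rcases Finset.mem_union.1 hv with hv | hv
        · obtain ⟨w, hw, -, hd⟩ := mem_childFinset.1 hv
          rw [hd, hA w hw]
        · exact (hRu' v hv).2) hu'd (Nat.mod_lt _ ha0) hu'
    refine ⟨A ∪ S, insert u B, ?_, ?_, ?_, ?_, (Finset.card_insert_le _ _).trans (by omega), ?_⟩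
    · intro x hx
      rcases Finset.mem_union.1 hx with hx | hx
      · exact (hA x hx).ge
      · exact (Nat.le_succ k).trans (hS1 x hx)
    · intro x hx
      rw [Finset.mem_union, or_iff_left]
      intro hxS
      have := hS1 x hxS
      omega
    · intro x hx y hy
      rw [Finset.mem_union] at hx ⊢
      refine .inr (hx.elim (fun hx => ?_) (fun hx => hS3 x hx y hy))
      rw [hS2 y (by rw [hy.2, hA x hx]), Finset.mem_union, mem_childFinset]
      exact .inl ⟨x, hx, hy⟩
    · rw [Finset.card_union_of_disjoint, hS4, Finset.card_union_of_disjoint hdisj, hR,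
        hT.card_childFinset fun v hv => by rw [hA v hv]; omega]
      · conv_rhs => rw [← Nat.div_add_mod s a]
        ring
      · rw [Finset.disjoint_left]
        intro x hx hxS
        have := hS1 x hxS
        have := hA x hx
        omega
    · intro v hv hvk y hy hyv
      rw [Finset.mem_union, not_or] at hv
      rw [Finset.mem_insert]
      have hyd := hyv.2
      rcases Finset.mem_union.1 hy with hy | hy
      · have := hA y hy
        omega
      rcases hvk.eq_or_lt with hvk | hvk
      · rw [hS2 y (by omega), Finset.mem_union, mem_childFinset] at hy
        left
        rcases hy with ⟨w, hw, hwy, hd⟩ | hy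
        · have : w = v := hT.isTree.eq_of_adj_of_dist_eq hwy hyv.1 hd hyd
          exact (hv.1 (this ▸ hw)).elim
        · exact hT.isTree.eq_of_adj_of_dist_eq hyv.1 (hRu' y hy).1 hyd (by
            rw [(hRu' y hy).2, hu])
      · exact .inr (hSB v hv.2 hvk y hy hyv)

lemma vertexIsoParam_le (hT : T.IsCompleteAryTree r q d) (hq : 0 < q) {s : ℕ}
    (hs : s ≤ Fintype.card V) : T.vertexIsoParam s ≤ d := by
  suffices h : ∃ S : Finset V, S.card = s ∧ (T.vertexBorder S).card ≤ d by
    obtain ⟨S, hS, hb⟩ := h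
    exact le_trans (Nat.sInf_le (Exists.intro S (And.intro hS rfl))) hb
  rcases hs.eq_or_lt with rfl | hs
  · refine ⟨Finset.univ, Finset.card_univ, ?_⟩
    rw [Finset.card_eq_zero.2 (Finset.eq_empty_of_forall_notMem fun v hv => ?_)]
    · exact Nat.zero_le d
    · simp [mem_vertexBorder] at hv
  · obtain ⟨S, B, -, -, h3, h4, hB, hSB⟩ := hT.exists_childClosed hq d 0 ∅ r s (by simp) (by simp)
      (by simp) (by rwa [← hT.card_univ]) (by simp)
    refine ⟨S, by simpa using h4, (Finset.card_le_card fun v hv => ?_).trans hB⟩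
    obtain ⟨hv, u, hu, hvu⟩ := mem_vertexBorder.1 hv
    rcases hT.isTree.dist_eq_dist_add_one_of_adj r hvu with h | h
    · exact (hv (h3 u hu v ⟨hvu.symm, h⟩)).elim
    · exact hSB v hv (Nat.zero_le _) u hu ⟨hvu, h⟩

/-! ### Lower bound: the extremal size -/

/-- The level sizes `0, 2, 2 q + 2, …`; a set with as many vertices as their sum has a large
border. -/
def extremalLevel (q : ℕ) : ℕ → ℕ
  | 0 => 0
  | k + 1 => q * extremalLevel q k + 2

lemma extremalLevel_lt_pow (hq : 3 ≤ q) (k : ℕ) : extremalLevel q k < q ^ k := by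
  induction k with
  | zero => simp [extremalLevel]
  | succ k ih =>
    rw [extremalLevel, pow_succ']
    nlinarith

lemma le_card_vertexBorder (hT : T.IsCompleteAryTree r q d) (hq : 5 ≤ q) {S : Finset V}
    (hS : S.card = ∑ k ∈ Finset.range (d + 1), extremalLevel q k) :
    d ≤ (T.vertexBorder S).card := by
  classical
  have hlt (v : V) : T.dist r v < d + 1 := Nat.lt_succ_of_le (hT.dist_le v)
  let x (k : ℕ) : Finset V := {v ∈ S | T.dist r v = k}
  let n (k : ℕ) : Finset V := {v ∈ T.vertexBorder S | T.dist r v = k}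
  let e (k : ℕ) : Finset V := {v ∈ T.childFinset r S \ S | T.dist r v = k}
  have hen (k : ℕ) : e k ⊆ n k := by
    intro v hv
    simp only [e, n, Finset.mem_filter, Finset.mem_sdiff, mem_childFinset, mem_vertexBorder] at hv ⊢
    obtain ⟨⟨⟨u, hu, huv, -⟩, hv⟩, hd⟩ := hv
    exact ⟨⟨hv, u, hu, huv.symm⟩, hd⟩
  -- Both sides count the union of `x (k + 1)` with the children of `x k`.
  have hrec (k : ℕ) (hk : k < d) : (x (k + 1)).card + (e (k + 1)).card =
      q * (x k).card + (x (k + 1) \ T.childFinset r (x k)).card := by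
    have he : e (k + 1) = T.childFinset r (x k) \ x (k + 1) := by
      ext v
      simp only [e, x, Finset.mem_filter, Finset.mem_sdiff, mem_childFinset]
      constructor
      · rintro ⟨⟨⟨u, hu, huv, hd⟩, hv⟩, hdv⟩
        exact ⟨⟨u, ⟨hu, by omega⟩, huv, hd⟩, fun h => hv h.1⟩
      · rintro ⟨⟨u, ⟨hu, hdu⟩, huv, hd⟩, hv⟩
        exact ⟨⟨⟨u, hu, huv, hd⟩, fun h => hv ⟨h, by omega⟩⟩, by omega⟩
    rw [he, ← hT.card_childFinset (A := x k) (fun v hv => by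
      have := (Finset.mem_filter.1 hv).2
      omega), add_comm (Finset.card _), Finset.card_sdiff_add_card,
      add_comm (Finset.card _), Finset.card_sdiff_add_card, Finset.union_comm]
  -- The parent of such a vertex is outside `S` but has a child in `S`, so it lies in `n k`.
  have hnew (k : ℕ) (hk : k < d) :
      (x (k + 1) \ T.childFinset r (x k)).card ≤ q * (n k).card := by
    rw [← hT.card_childFinset (A := n k) (fun v hv => by
      have := (Finset.mem_filter.1 hv).2
      omega)]
    refine Finset.card_le_card fun v hv => ?_
    simp only [x, n, Finset.mem_filter, Finset.mem_sdiff, mem_childFinset, mem_vertexBorder] at hv ⊢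
    obtain ⟨⟨hvS, hd⟩, hv⟩ := hv
    obtain ⟨u, huv, hdu⟩ := hT.isTree.connected.exists_adj_dist_eq hd
    exact ⟨u, ⟨⟨fun hu => hv ⟨u, ⟨hu, hdu⟩, huv, by omega⟩, v, hvS, huv⟩, hdu⟩, huv, by omega⟩
  have hx0 : (x 0).card ≤ 1 := by
    have := hT.card_level (Nat.zero_le d)
    rw [pow_zero] at this
    rw [← this]
    exact Finset.card_le_card fun v hv => by simpa using (Finset.mem_filter.1 hv).2
  have he0 : (e 0).card = 0 := by
    rw [Finset.card_eq_zero]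
    refine Finset.eq_empty_of_forall_notMem fun v hv => ?_
    simp only [e, Finset.mem_filter, Finset.mem_sdiff, mem_childFinset] at hv
    obtain ⟨⟨⟨u, hu, huv, hd⟩, -⟩, h0⟩ := hv
    omega
  have key := le_sum_of_recursion (q := q) (by exact_mod_cast hq) d
    (fun k => (extremalLevel q k : ℤ) - (x k).card - (e k).card) (fun k => (n k).card)
    (fun k => (e k).card) (by simp only [extremalLevel]; omega) (fun k => by positivity)
    (fun k => by exact_mod_cast Finset.card_le_card (hen k)) ?_ ?_ ?_
  · rw [card_eq_sum_level (G := T) (r := r) (n := d + 1) _ fun v _ => hlt v]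
    exact_mod_cast key
  · intro k hk
    have h1 := hrec k hk
    have h2 := hnew k hk
    zify at h1 h2
    simp only [extremalLevel]
    push_cast
    linarith
  · intro k hk
    have h1 := hrec k hk
    zify at h1
    simp only [extremalLevel]
    push_cast
    linarith
  · rw [card_eq_sum_level (G := T) (r := r) (n := d + 1) _ fun v _ => hlt v] at hS
    simp only [sub_add_cancel, Finset.sum_sub_distrib]
    rw [sub_eq_zero]
    exact_mod_cast hS.symm

end IsCompleteAryTree

end

end SimpleGraph

open SimpleGraph in
theorem theorem1p4 {V : Type*} [Fintype V] (T : SimpleGraph V) (r : V) (q d : ℕ)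
    (hq : 5 ≤ q) (hT : T.IsCompleteAryTree r q d) :
    T.vertexIsoPeak = d := by
  refine le_antisymm (Finset.sup_le fun s hs => hT.vertexIsoParam_le (by omega) ?_) ?_
  · simpa [Nat.lt_succ_iff] using hs
  · set s := ∑ k ∈ Finset.range (d + 1), IsCompleteAryTree.extremalLevel q k
    have hs : s ≤ Fintype.card V := by
      rw [hT.card_univ]
      exact Finset.sum_le_sum fun k _ =>
        (IsCompleteAryTree.extremalLevel_lt_pow (by omega) k).le
    obtain ⟨S₀, -, hS₀⟩ := Finset.exists_subset_card_eq (s := (Finset.univ : Finset V)) hs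
    refine le_trans (le_csInf (Set.nonempty_of_mem (Exists.intro S₀ (And.intro hS₀ rfl))) ?_)
      (Finset.le_sup (f := T.vertexIsoParam) (b := s) (by simpa [Nat.lt_succ_iff] using hs))
    rintro _ ⟨S, hS, rfl⟩
    exact hT.le_card_vertexBorder hq hS
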